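/- Let $G$ be a finite group. A rational $G$-Mackey functor $M$ consists of a $\mathbb{Q}$-vector space $M(G/H)$ for each subgroup $H\le G$ and $\mathbb{Q}$-linear restriction maps $R^H_K\colon M(G/H)\to M(G/K)$, induction maps $I^H_K\colon M(G/K)\to M(G/H)$ (for $K\le H$) and conjugation maps $C_g\colon M(G/H)\to M(G/gHg^{-1})$ (for $g\in G$) such that: $R^H_H=I^H_H=\mathrm{id}$, and $C_h=\mathrm{id}$ on $M(G/H)$ for $h\in H$; restriction, induction and conjugation are transitive ($R^H_L=R^K_LR^H_K$, $I^H_L=I^H_KI^K_L$, $C_{gh}=C_gC_h$); conjugation commutes with restriction and induction; and for $K,L\le H$ the Mackey axiom $$R^H_K\circ I^H_L=\sum_{x\in[K\backslash H/L]} I^K_{K\cap xLx^{-1}}\circ C_x\circ R^L_{L\cap x^{-1}Kx}$$ holds. For $H\le G$ let $A_{\mathbb{Q}}(H)$ be the rational Burnside ring (the rational Grothendieck ring of finite $H$-sets). It acts on $M(G/H)$ by extending $[H/L]\mapsto I^H_L\circ R^H_L$ linearly. For $K\le H$ let $e_K^H\in A_{\mathbb{Q}}(H)$ be the idempotent characterised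 by $|(e_K^H)^L|=1$ if $L$ is $H$-conjugate to $K$ and $|(e_K^H)^L|=0$ for every other subgroup $L\le H$, where $X\mapsto |X^L|$ is extended linearly to $A_{\mathbb{Q}}(H)$. The Weyl group $W_HK=N_HK/K$ acts on $M(G/K)$ through the conjugation maps. Theorem. For every finite group $G$, every rational $G$-Mackey functor $M$ and all subgroups $K\le H\le G$, there is an isomorphism of $\mathbb{Q}$-vector spaces $$e_K^H M(G/H)\;\cong\;\big(e_K^K M(G/K)\big)^{W_HK};$$ more precisely, the restriction map $R^H_K\colon M(G/H)\to M(G/K)$ restricts to such an isomorphism. -/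

import Mathlib

universe u v

/-- The conjugate `g H g⁻¹` of a subgroup. -/
def conjSub {G : Type*} [Group G] (g : G) (H : Subgroup G) : Subgroup G :=
  H.map (MulAut.conj g).toMonoidHom

section conjSub

variable {G : Type*} [Group G]

theorem mem_conjSub {g x : G} {H : Subgroup G} : x ∈ conjSub g H ↔ g⁻¹ * x * g ∈ H := by
  rw [conjSub, Subgroup.mem_map]
  constructor
  · rintro ⟨y, hy, rfl⟩
    simpa [mul_assoc] using hy
  · intro h
    exact ⟨_, h, by simp [mul_assoc]⟩

theorem conjSub_one (H : Subgroup G) : conjSub 1 H = H := by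
  ext x
  simp [mem_conjSub]

theorem conjSub_conjSub (g h : G) (H : Subgroup G) :
    conjSub g (conjSub h H) = conjSub (g * h) H := by
  ext x
  simp [mem_conjSub, mul_assoc]

theorem conjSub_mono (g : G) {K H : Subgroup G} (h : K ≤ H) : conjSub g K ≤ conjSub g H :=
  Subgroup.map_mono h

theorem conjSub_self {H : Subgroup G} {h : G} (hh : h ∈ H) : H = conjSub h H := by
  ext x
  rw [mem_conjSub, H.mul_mem_cancel_right hh, H.mul_mem_cancel_left (H.inv_mem hh)]

theorem card_conjSub (g : G) (H : Subgroup G) : Nat.card (conjSub g H) = Nat.card H :=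
  Subgroup.card_map_of_injective (MulAut.conj g).injective

end conjSub

/-! ### Finite `H`-sets and the rational Burnside ring -/

/-- A finite set with a left action of the group `H`. -/
structure FinGSet (H : Type u) [Group H] where
  carrier : Type u
  [action : MulAction H carrier]
  [finite : Finite carrier]

namespace FinGSet

variable {H : Type u} [Group H]

instance instAction (X : FinGSet H) : MulAction H X.carrier := X.action

instance instFinite (X : FinGSet H) : Finite X.carrier := X.finite

/-- Two finite `H`-sets are isomorphic if there is an equivariant bijection between them. -/
def Iso (X Y : FinGSet H) : Prop :=
  ∃ e : X.carrier ≃ Y.carrier, ∀ (h : H) (x : X.carrier), e (h • x) = h • e x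

instance isoSetoid (H : Type u) [Group H] : Setoid (FinGSet H) where
  r := Iso
  iseqv :=
    { refl := fun _ => ⟨Equiv.refl _, fun _ _ => rfl⟩
      symm := by
        rintro X Y ⟨e, he⟩
        refine ⟨e.symm, fun h y => ?_⟩
        rw [Equiv.symm_apply_eq, he, Equiv.apply_symm_apply]
      trans := by
        rintro X Y Z ⟨e, he⟩ ⟨f, hf⟩
        exact ⟨e.trans f, fun h x => by simp [he, hf]⟩ }

/-- The disjoint union of two finite `H`-sets. -/
def sum (X Y : FinGSet H) : FinGSet H where
  carrier := X.carrier ⊕ Y.carrier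
  action :=
    { smul := fun h => Sum.map (fun x => h • x) (fun y => h • y)
      one_smul := by
        rintro (x | y)
        · exact congrArg Sum.inl (one_smul H x)
        · exact congrArg Sum.inr (one_smul H y)
      mul_smul := by
        rintro g h (x | y)
        · exact congrArg Sum.inl (mul_smul g h x)
        · exact congrArg Sum.inr (mul_smul g h y) }

/-- The cartesian product of two finite `H`-sets, with the diagonal action. -/
def prod (X Y : FinGSet H) : FinGSet H where
  carrier := X.carrier × Y.carrier

/-- The one-point `H`-set. -/
def point (H : Type u) [Group H] : FinGSet H where
  carrier := PUnit

/-- The transitive `H`-set `H / L`. -/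
def coset [Finite H] (L : Subgroup H) : FinGSet H where
  carrier := H ⧸ L

theorem Iso.stabilizer_eq {X Y : FinGSet H} {e : X.carrier ≃ Y.carrier}
    (he : ∀ (h : H) (x : X.carrier), e (h • x) = h • e x) (x : X.carrier) :
    MulAction.stabilizer H (e x) = MulAction.stabilizer H x := by
  ext h
  rw [MulAction.mem_stabilizer_iff, MulAction.mem_stabilizer_iff, ← he, e.apply_eq_iff_eq]

theorem stabilizer_inl (X Y : FinGSet H) (x : X.carrier) :
    MulAction.stabilizer H (Sum.inl x : (X.sum Y).carrier) = MulAction.stabilizer H x := by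
  ext h
  exact Sum.inl_injective.eq_iff (a := h • x) (b := x)

theorem stabilizer_inr (X Y : FinGSet H) (y : Y.carrier) :
    MulAction.stabilizer H (Sum.inr y : (X.sum Y).carrier) = MulAction.stabilizer H y := by
  ext h
  exact Sum.inr_injective.eq_iff (a := h • y) (b := y)

/-- The complement of an orbit. -/
def orbitCompl (X : FinGSet H) (x : X.carrier) : FinGSet H where
  carrier := {y : X.carrier // y ∉ MulAction.orbit H x}
  action :=
    { smul := fun h y => ⟨h • y.1, fun hy => y.2 (by
        have := MulAction.mem_orbit_of_mem_orbit h⁻¹ hy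
        rwa [inv_smul_smul] at this)⟩
      one_smul := fun y => Subtype.ext (one_smul H y.1)
      mul_smul := fun g h y => Subtype.ext (mul_smul g h y.1) }

theorem iso_orbit_sum [Finite H] (X : FinGSet H) (x : X.carrier) :
    Iso ((coset (MulAction.stabilizer H x)).sum (X.orbitCompl x)) X := by
  let f : ((coset (MulAction.stabilizer H x)).sum (X.orbitCompl x)).carrier → X.carrier :=
    Sum.elim (MulAction.ofQuotientStabilizer H x) Subtype.val
  have hf : Function.Bijective f := by
    constructor
    · rintro (a | a) (b | b) hab
      · exact congrArg Sum.inl (MulAction.injective_ofQuotientStabilizer H x hab)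
      · exact absurd (Eq.subst (motive := (· ∈ MulAction.orbit H x)) hab
          (MulAction.ofQuotientStabilizer_mem_orbit H x a)) b.2
      · exact absurd (Eq.subst (motive := (· ∈ MulAction.orbit H x)) hab.symm
          (MulAction.ofQuotientStabilizer_mem_orbit H x b)) a.2
      · exact congrArg Sum.inr (Subtype.ext hab)
    · intro y
      by_cases hy : y ∈ MulAction.orbit H x
      · obtain ⟨h, rfl⟩ := hy
        exact ⟨Sum.inl (QuotientGroup.mk h), rfl⟩
      · exact ⟨Sum.inr ⟨y, hy⟩, rfl⟩
  refine ⟨Equiv.ofBijective f hf, ?_⟩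
  rintro h (a | a)
  · exact MulAction.ofQuotientStabilizer_smul H x h a
  · rfl

/-- Every finite `H`-set is a disjoint union of sets `H / L`; hence two functions on finite
`H`-sets that are invariant under isomorphism, additive on disjoint unions, and equal on the sets
`H / L`, are equal. -/
theorem additive_ext [Finite H] {V : Type*} [AddCommGroup V] {f g : FinGSet H → V}
    (fiso : ∀ X Y, Iso X Y → f X = f Y) (fsum : ∀ X Y, f (X.sum Y) = f X + f Y)
    (giso : ∀ X Y, Iso X Y → g X = g Y) (gsum : ∀ X Y, g (X.sum Y) = g X + g Y)
    (h : ∀ L, f (coset L) = g (coset L)) (X : FinGSet H) : f X = g X := by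
  induction hn : Nat.card X.carrier using Nat.strong_induction_on generalizing X with
  | _ n ih =>
    rcases isEmpty_or_nonempty X.carrier with hX | ⟨⟨x⟩⟩
    · have hi : Iso (X.sum X) X :=
        ⟨⟨Sum.elim id id, fun x => (hX.false x).elim, fun x => by
            rcases x with x | x <;> exact (hX.false x).elim, fun x => (hX.false x).elim⟩,
          fun _ x => by rcases x with x | x <;> exact (hX.false x).elim⟩
      have h₁ := fsum X X
      have h₂ := gsum X X
      rw [fiso _ _ hi] at h₁
      rw [giso _ _ hi] at h₂
      rw [left_eq_add.mp h₁, left_eq_add.mp h₂]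
    · have hi := X.iso_orbit_sum x
      have hlt : Nat.card (X.orbitCompl x).carrier < n := by
        rw [← hn]
        exact Finite.card_subtype_lt (x := x) (fun hx => hx (MulAction.mem_orbit_self x))
      rw [← fiso _ _ hi, ← giso _ _ hi, fsum, gsum, h, ih _ hlt _ rfl]

/-- The sum over the orbits of `X` of the values of `φ` at the stabilizer of a point of the orbit,
for a function `φ` on subgroups that is constant on conjugacy classes; the choice of points is
avoided by averaging over each orbit. -/
noncomputable def orbitSum {V : Type*} [AddCommGroup V] [Module ℚ V] (φ : Subgroup H → V)
    (X : FinGSet H) : V :=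
  ∑ᶠ x : X.carrier, ((Nat.card (MulAction.stabilizer H x) : ℚ) / Nat.card H) •
    φ (MulAction.stabilizer H x)

theorem orbitSum_iso {V : Type*} [AddCommGroup V] [Module ℚ V] (φ : Subgroup H → V)
    (X Y : FinGSet H) (h : Iso X Y) : orbitSum φ X = orbitSum φ Y := by
  obtain ⟨e, he⟩ := h
  rw [orbitSum, orbitSum, ← finsum_comp_equiv e]
  simp only [Iso.stabilizer_eq he]

theorem orbitSum_sum {V : Type*} [AddCommGroup V] [Module ℚ V] (φ : Subgroup H → V)
    (X Y : FinGSet H) : orbitSum φ (X.sum Y) = orbitSum φ X + orbitSum φ Y := by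
  let := Fintype.ofFinite X.carrier
  let := Fintype.ofFinite Y.carrier
  let : Fintype (X.sum Y).carrier := inferInstanceAs (Fintype (X.carrier ⊕ Y.carrier))
  rw [orbitSum, orbitSum, orbitSum, finsum_eq_sum_of_fintype, finsum_eq_sum_of_fintype,
    finsum_eq_sum_of_fintype]
  let F : Subgroup H → V := fun S => ((Nat.card S : ℚ) / Nat.card H) • φ S
  refine (Fintype.sum_sum_type _).trans (congrArg₂ _ ?_ ?_)
  · exact Finset.sum_congr rfl fun x _ => congrArg F (stabilizer_inl X Y x)
  · exact Finset.sum_congr rfl fun y _ => congrArg F (stabilizer_inr X Y y)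

theorem stabilizer_coset_mk [Finite H] (L : Subgroup H) (h : H) :
    MulAction.stabilizer H (QuotientGroup.mk h : (coset L).carrier) = conjSub h L := by
  have h₁ := MulAction.stabilizer_smul_eq_stabilizer_map_conj h ((1 : H) : H ⧸ L)
  rw [MulAction.stabilizer_quotient] at h₁
  rw [conjSub, ← h₁, MulAction.Quotient.smul_coe, smul_eq_mul, mul_one]

theorem stabilizer_coset [Finite H] (L : Subgroup H) (x : (coset L).carrier) :
    ∃ h : H, MulAction.stabilizer H x = conjSub h L := by
  obtain ⟨h, rfl⟩ := QuotientGroup.mk_surjective (s := L) x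
  exact ⟨h, stabilizer_coset_mk L h⟩

/-- The orbit sum on a transitive `H`-set is the value at the subgroup. -/
theorem orbitSum_coset [Finite H] {V : Type*} [AddCommGroup V] [Module ℚ V] (φ : Subgroup H → V)
    (hφ : ∀ (h : H) (L : Subgroup H), φ (conjSub h L) = φ L)
    (L : Subgroup H) : orbitSum φ (coset L) = φ L := by
  let : Fintype (coset L).carrier := Fintype.ofFinite _
  rw [orbitSum, finsum_eq_sum_of_fintype]
  have hterm : ∀ x : (coset L).carrier,
      ((Nat.card (MulAction.stabilizer H x) : ℚ) / Nat.card H) • φ (MulAction.stabilizer H x) =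
        ((Nat.card L : ℚ) / Nat.card H) • φ L := by
    intro x
    obtain ⟨h, hx⟩ := stabilizer_coset L x
    rw [hx, hφ, card_conjSub]
  rw [Finset.sum_congr rfl (fun x _ => hterm x), Finset.sum_const, Finset.card_univ,
    ← Nat.card_eq_fintype_card, ← Nat.cast_smul_eq_nsmul ℚ, smul_smul]
  have hc : (Nat.card (coset L).carrier : ℚ) * Nat.card L = Nat.card H := by
    have := L.card_eq_card_quotient_mul_card_subgroup
    exact_mod_cast this.symm
  rw [← mul_div_assoc, hc, div_self (by exact_mod_cast Nat.card_pos.ne'), one_smul]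

theorem Iso.prod {X X' Y Y' : FinGSet H} (h₁ : Iso X X') (h₂ : Iso Y Y') :
    Iso (X.prod Y) (X'.prod Y') := by
  obtain ⟨e, he⟩ := h₁
  obtain ⟨f, hf⟩ := h₂
  exact ⟨e.prodCongr f, fun h x => Prod.ext (he h x.1) (hf h x.2)⟩

theorem prod_sum_iso (Z X Y : FinGSet H) :
    Iso (Z.prod (X.sum Y)) ((Z.prod X).sum (Z.prod Y)) := by
  refine ⟨Equiv.prodSumDistrib _ _ _, ?_⟩
  rintro h ⟨z, x | y⟩ <;> rfl

end FinGSet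

/-- Isomorphism classes of finite `H`-sets. -/
def FinGSetClass (H : Type u) [Group H] : Type (u + 1) := Quotient (FinGSet.isoSetoid H)

/-- The isomorphism class of a finite `H`-set. -/
def FinGSetClass.mk {H : Type u} [Group H] (X : FinGSet H) : FinGSetClass H := Quotient.mk _ X

/-- Isomorphism classes of finite `H`-sets form a commutative monoid under cartesian product. -/
instance FinGSetClass.instCommMonoid (H : Type u) [Group H] : CommMonoid (FinGSetClass H) where
  mul := Quotient.map₂ FinGSet.prod (fun _ _ h₁ _ _ h₂ => FinGSet.Iso.prod h₁ h₂)
  one := FinGSetClass.mk (FinGSet.point H)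
  mul_assoc := by
    rintro ⟨X⟩ ⟨Y⟩ ⟨Z⟩
    exact Quotient.sound ⟨Equiv.prodAssoc _ _ _, fun _ _ => rfl⟩
  one_mul := by
    rintro ⟨X⟩
    exact Quotient.sound ⟨Equiv.punitProd _, fun _ _ => rfl⟩
  mul_one := by
    rintro ⟨X⟩
    exact Quotient.sound ⟨Equiv.prodPUnit _, fun _ _ => rfl⟩
  mul_comm := by
    rintro ⟨X⟩ ⟨Y⟩
    exact Quotient.sound ⟨Equiv.prodComm _ _, fun _ _ => rfl⟩

theorem FinGSetClass.mk_mul {H : Type u} [Group H] (X Y : FinGSet H) :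
    FinGSetClass.mk X * FinGSetClass.mk Y = FinGSetClass.mk (X.prod Y) := rfl

/-- The ideal of relations `[X ⊔ Y] = [X] + [Y]`. -/
noncomputable def burnsideIdeal (H : Type u) [Group H] :
    Ideal (MonoidAlgebra ℚ (FinGSetClass H)) :=
  Ideal.span {r | ∃ X Y : FinGSet H, r =
    MonoidAlgebra.of ℚ (FinGSetClass H) (FinGSetClass.mk (X.sum Y))
      - (MonoidAlgebra.of ℚ (FinGSetClass H) (FinGSetClass.mk X)
      + MonoidAlgebra.of ℚ (FinGSetClass H) (FinGSetClass.mk Y))}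

/-- The rational Burnside ring of `H`: the rational Grothendieck ring of finite `H`-sets, i.e. the
commutative `ℚ`-algebra generated by the classes `[X]` of finite `H`-sets, with addition given by
disjoint union and multiplication given by cartesian product. -/
abbrev RatBurnside (H : Type u) [Group H] : Type (u + 1) :=
  MonoidAlgebra ℚ (FinGSetClass H) ⧸ burnsideIdeal H

namespace RatBurnside

variable {H : Type u} [Group H]

/-- The class `[X]` of a finite `H`-set in the rational Burnside ring. -/
noncomputable def cls (X : FinGSet H) : RatBurnside H :=
  Ideal.Quotient.mk (burnsideIdeal H) (MonoidAlgebra.of ℚ (FinGSetClass H) (FinGSetClass.mk X))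

theorem cls_iso {X Y : FinGSet H} (h : FinGSet.Iso X Y) : cls X = cls Y := by
  have : FinGSetClass.mk X = FinGSetClass.mk Y := Quotient.sound h
  rw [cls, cls, this]

theorem cls_sum (X Y : FinGSet H) : cls (X.sum Y) = cls X + cls Y := by
  rw [cls, cls, cls, ← map_add]
  exact Ideal.Quotient.eq.mpr (Ideal.subset_span ⟨X, Y, rfl⟩)

theorem cls_prod (X Y : FinGSet H) : cls (X.prod Y) = cls X * cls Y := by
  rw [cls, cls, cls, ← map_mul, ← map_mul, FinGSetClass.mk_mul]

theorem mk_single (X : FinGSet H) (q : ℚ) :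
    Ideal.Quotient.mk (burnsideIdeal H) (MonoidAlgebra.single (FinGSetClass.mk X) q) =
      q • cls X := by
  have e : (MonoidAlgebra.single (FinGSetClass.mk X) q) =
      q • MonoidAlgebra.of ℚ (FinGSetClass H) (FinGSetClass.mk X) := by
    rw [MonoidAlgebra.of_apply, MonoidAlgebra.smul_single, smul_eq_mul, mul_one]
  rw [e, cls]
  rfl

/-- The rational Burnside ring is spanned by the classes of finite `H`-sets. -/
theorem induction_cls {p : RatBurnside H → Prop} (b : RatBurnside H) (zero : p 0)
    (add : ∀ a b, p a → p b → p (a + b)) (smul : ∀ (q : ℚ) X, p (q • cls X)) : p b := by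
  obtain ⟨a, rfl⟩ := Ideal.Quotient.mk_surjective b
  induction a using MonoidAlgebra.induction_linear with
  | zero => rw [map_zero]; exact zero
  | add f g hf hg => rw [map_add]; exact add _ _ hf hg
  | single x q =>
    obtain ⟨X, rfl⟩ : ∃ X, FinGSetClass.mk X = x := Quotient.exists_rep x
    rw [mk_single]
    exact smul q X

theorem hom_ext {V : Type*} [AddCommGroup V] [Module ℚ V] {S T : RatBurnside H →ₗ[ℚ] V}
    (h : ∀ X, S (cls X) = T (cls X)) : S = T := by
  refine LinearMap.ext fun b => ?_
  refine induction_cls (p := fun b => S b = T b) b ?_ ?_ ?_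
  · rw [map_zero, map_zero]
  · intro a b ha hb
    rw [map_add, map_add, ha, hb]
  · intro q X
    rw [map_smul, map_smul, h]

/-- Linear extension to the monoid algebra of an isomorphism invariant of finite `H`-sets. -/
noncomputable def preLift {V : Type*} [AddCommGroup V] [Module ℚ V] (f : FinGSet H → V)
    (hiso : ∀ X Y, FinGSet.Iso X Y → f X = f Y) :
    MonoidAlgebra ℚ (FinGSetClass H) →ₗ[ℚ] V :=
  (Finsupp.linearCombination ℚ (Quotient.lift f hiso : FinGSetClass H → V)) ∘ₗ
    (MonoidAlgebra.coeffLinearEquiv ℚ).toLinearMap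

theorem preLift_single {V : Type*} [AddCommGroup V] [Module ℚ V] (f : FinGSet H → V)
    (hiso : ∀ X Y, FinGSet.Iso X Y → f X = f Y) (X : FinGSet H) (q : ℚ) :
    preLift f hiso (MonoidAlgebra.single (FinGSetClass.mk X) q) = q • f X := by
  exact Finsupp.linearCombination_single ℚ q (FinGSetClass.mk X)

theorem preLift_eq_zero {V : Type*} [AddCommGroup V] [Module ℚ V] (f : FinGSet H → V)
    (hiso : ∀ X Y, FinGSet.Iso X Y → f X = f Y) (hsum : ∀ X Y, f (X.sum Y) = f X + f Y)
    (r : MonoidAlgebra ℚ (FinGSetClass H)) (hr : r ∈ burnsideIdeal H) :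
    preLift f hiso r = 0 := by
  suffices h : ∀ a, preLift f hiso (a * r) = 0 by simpa using h 1
  induction hr using Submodule.span_induction with
  | mem r hr =>
    obtain ⟨X, Y, rfl⟩ := hr
    intro a
    induction a using MonoidAlgebra.induction_linear with
    | zero => rw [zero_mul, map_zero]
    | add a b ha hb => rw [add_mul, map_add, ha, hb, add_zero]
    | single z q =>
      obtain ⟨Z, rfl⟩ : ∃ Z, FinGSetClass.mk Z = z := Quotient.exists_rep z
      simp only [MonoidAlgebra.of_apply, mul_sub, mul_add, MonoidAlgebra.single_mul_single,
        mul_one, FinGSetClass.mk_mul, map_sub, map_add, preLift_single]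
      rw [hiso _ _ (FinGSet.prod_sum_iso Z X Y), hsum, smul_add, sub_self]
  | zero => intro a; rw [mul_zero, map_zero]
  | add x y _ _ hx hy => intro a; rw [mul_add, map_add, hx, hy, add_zero]
  | smul c x _ hx => intro a; rw [smul_eq_mul, ← mul_assoc]; exact hx _

/-- Linear extension to the rational Burnside ring of a function on finite `H`-sets that is
invariant under isomorphism and additive on disjoint unions. -/
noncomputable def liftAdditive {V : Type*} [AddCommGroup V] [Module ℚ V] (f : FinGSet H → V)
    (hiso : ∀ X Y, FinGSet.Iso X Y → f X = f Y) (hsum : ∀ X Y, f (X.sum Y) = f X + f Y) :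
    RatBurnside H →ₗ[ℚ] V :=
  (((burnsideIdeal H).restrictScalars ℚ).liftQ (preLift f hiso)
    (fun r hr => preLift_eq_zero f hiso hsum r hr)) ∘ₗ
      (Submodule.Quotient.restrictScalarsEquiv ℚ (burnsideIdeal H)).symm.toLinearMap

theorem liftAdditive_cls {V : Type*} [AddCommGroup V] [Module ℚ V] (f : FinGSet H → V)
    (hiso : ∀ X Y, FinGSet.Iso X Y → f X = f Y) (hsum : ∀ X Y, f (X.sum Y) = f X + f Y)
    (X : FinGSet H) : liftAdditive f hiso hsum (cls X) = f X := by
  have h := preLift_single f hiso X 1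
  rw [one_smul] at h
  exact h

theorem hom_ext_coset [Finite H] {V : Type*} [AddCommGroup V] [Module ℚ V]
    {S T : RatBurnside H →ₗ[ℚ] V}
    (h : ∀ L, S (cls (FinGSet.coset L)) = T (cls (FinGSet.coset L))) : S = T :=
  hom_ext (FinGSet.additive_ext (f := fun X => S (cls X)) (g := fun X => T (cls X))
    (fun _ _ hi => by rw [cls_iso hi]) (fun _ _ => by rw [cls_sum, map_add])
    (fun _ _ hi => by rw [cls_iso hi]) (fun _ _ => by rw [cls_sum, map_add]) h)

/-- The `L`-component of tom Dieck's map, `[X] ↦ |X^L|`. -/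
noncomputable def mark (L : Subgroup H) : RatBurnside H →ₗ[ℚ] ℚ :=
  liftAdditive (fun X => (Nat.card {x : X.carrier // ∀ h ∈ L, h • x = x} : ℚ))
    (by
      rintro X Y ⟨e, he⟩
      refine congrArg Nat.cast (Nat.card_congr (e.subtypeEquiv fun x => ?_))
      simp only [← he, e.apply_eq_iff_eq])
    (by
      intro X Y
      rw [← Nat.cast_add, ← Nat.card_sum]
      refine congrArg Nat.cast (Nat.card_congr (Equiv.trans Equiv.subtypeSum
        (Equiv.sumCongr (Equiv.subtypeEquivRight fun x => ?_)
          (Equiv.subtypeEquivRight fun y => ?_))))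
      · exact forall₂_congr fun h _ => Sum.inl_injective.eq_iff (a := h • x) (b := x)
      · exact forall₂_congr fun h _ => Sum.inr_injective.eq_iff (a := h • y) (b := y))

theorem mark_cls (L : Subgroup H) (X : FinGSet H) :
    mark L (cls X) = Nat.card {x : X.carrier // ∀ h ∈ L, h • x = x} :=
  liftAdditive_cls _ _ _ X

/-- The number of points with stabilizer `L`. -/
noncomputable def stabCount (L : Subgroup H) : RatBurnside H →ₗ[ℚ] ℚ :=
  liftAdditive (fun X => (Nat.card {x : X.carrier // MulAction.stabilizer H x = L} : ℚ))
    (by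
      rintro X Y ⟨e, he⟩
      refine congrArg Nat.cast (Nat.card_congr (e.subtypeEquiv fun x => ?_))
      rw [FinGSet.Iso.stabilizer_eq he])
    (by
      intro X Y
      rw [← Nat.cast_add, ← Nat.card_sum]
      refine congrArg Nat.cast (Nat.card_congr (Equiv.trans Equiv.subtypeSum
        (Equiv.sumCongr (Equiv.subtypeEquivRight fun x => ?_)
          (Equiv.subtypeEquivRight fun y => ?_))))
      · exact iff_of_eq (congrArg (· = L) (FinGSet.stabilizer_inl X Y x))
      · exact iff_of_eq (congrArg (· = L) (FinGSet.stabilizer_inr X Y y)))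

theorem stabCount_cls (L : Subgroup H) (X : FinGSet H) :
    stabCount L (cls X) = Nat.card {x : X.carrier // MulAction.stabilizer H x = L} :=
  liftAdditive_cls _ _ _ X

open Classical in
theorem mark_eq_sum [Finite H] [Fintype (Subgroup H)] (L : Subgroup H) (b : RatBurnside H) :
    mark L b = ∑ L' : Subgroup H, if L ≤ L' then stabCount L' b else 0 := by
  have h : mark L = ∑ L' : Subgroup H, if L ≤ L' then stabCount L' else 0 := by
    refine hom_ext fun X => ?_
    let := Fintype.ofFinite X.carrier
    rw [mark_cls, LinearMap.sum_apply]
    simp only [apply_ite (fun T : RatBurnside H →ₗ[ℚ] ℚ => T (cls X)), stabCount_cls,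
      LinearMap.zero_apply, Nat.card_eq_fintype_card, Fintype.card_subtype]
    have hm : ∀ x : X.carrier, (∀ h ∈ L, h • x = x) ↔ L ≤ MulAction.stabilizer H x :=
      fun x => Iff.rfl
    simp only [hm]
    rw [Finset.card_eq_sum_card_fiberwise (f := fun x => MulAction.stabilizer H x)
      (t := Finset.univ) (fun _ _ => Finset.mem_univ _), Nat.cast_sum]
    refine Finset.sum_congr rfl fun L' _ => ?_
    split_ifs with hL
    · congr 2
      ext x
      simp only [Finset.mem_filter, Finset.mem_univ, true_and, and_iff_right_iff_imp]
      rintro rfl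
      exact hL
    · rw [Nat.cast_eq_zero, Finset.card_eq_zero, Finset.filter_eq_empty_iff]
      rintro x hx rfl
      exact hL (Finset.mem_filter.mp hx).2
  rw [h, LinearMap.sum_apply]
  refine Finset.sum_congr rfl fun L' _ => ?_
  split_ifs <;> rfl

theorem stabCount_eq_zero [Finite H] {b : RatBurnside H} (hb : ∀ L, mark L b = 0)
    (L : Subgroup H) : stabCount L b = 0 := by
  classical
  let := Fintype.ofFinite (Subgroup H)
  induction L using WellFoundedGT.induction with
  | ind L ih =>
    have h := mark_eq_sum L b
    rw [hb, Finset.sum_eq_single L, if_pos le_rfl] at h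
    · exact h.symm
    · intro L' _ hne
      split_ifs with hle
      · exact ih L' (lt_of_le_of_ne hle hne.symm)
      · rfl
    · intro h'
      exact absurd (Finset.mem_univ _) h'

theorem cls_coset_conj [Finite H] (h : H) (L : Subgroup H) :
    cls (FinGSet.coset (conjSub h L)) = cls (FinGSet.coset L) := by
  rw [← FinGSet.stabilizer_coset_mk]
  refine cls_iso ⟨Equiv.ofBijective (MulAction.ofQuotientStabilizer H
    (QuotientGroup.mk h : (FinGSet.coset L).carrier))
    ⟨MulAction.injective_ofQuotientStabilizer H _, fun y => ?_⟩,
    fun g x => MulAction.ofQuotientStabilizer_smul H _ g x⟩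
  obtain ⟨k, rfl⟩ := QuotientGroup.mk_surjective (s := L) y
  refine ⟨QuotientGroup.mk (k * h⁻¹), ?_⟩
  change (QuotientGroup.mk (k * h⁻¹ * h) : H ⧸ L) = QuotientGroup.mk k
  rw [inv_mul_cancel_right]

theorem eq_sum_stabCount [Finite H] [Fintype (Subgroup H)] (b : RatBurnside H) :
    b = ∑ L : Subgroup H, ((Nat.card L : ℚ) / Nat.card H * stabCount L b) •
      cls (FinGSet.coset L) := by
  classical
  have h : (LinearMap.id : RatBurnside H →ₗ[ℚ] RatBurnside H) = ∑ L : Subgroup H,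
      ((Nat.card L : ℚ) / Nat.card H) • (stabCount L).smulRight (cls (FinGSet.coset L)) := by
    refine hom_ext fun X => ?_
    let := Fintype.ofFinite X.carrier
    have hX := FinGSet.additive_ext (f := cls)
      (g := FinGSet.orbitSum fun L => cls (FinGSet.coset L)) (fun _ _ => cls_iso) cls_sum
      (FinGSet.orbitSum_iso _) (FinGSet.orbitSum_sum _)
      (fun L => (FinGSet.orbitSum_coset (fun L => cls (FinGSet.coset L)) cls_coset_conj L).symm) X
    rw [LinearMap.id_apply, LinearMap.sum_apply]
    refine hX.trans ?_
    rw [FinGSet.orbitSum, finsum_eq_sum_of_fintype,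
      ← Finset.sum_fiberwise Finset.univ (fun x : X.carrier => MulAction.stabilizer H x)]
    refine Finset.sum_congr rfl fun L _ => ?_
    rw [LinearMap.smul_apply, LinearMap.smulRight_apply, stabCount_cls, Nat.card_eq_fintype_card
      (α := {x : X.carrier // _}), Fintype.card_subtype, smul_comm, Nat.cast_smul_eq_nsmul,
      ← Finset.sum_const]
    refine Finset.sum_congr rfl fun x hx => ?_
    rw [(Finset.mem_filter.mp hx).2]
  have h' := LinearMap.congr_fun h b
  rw [LinearMap.id_apply, LinearMap.sum_apply] at h'
  refine h'.trans (Finset.sum_congr rfl fun L _ => ?_)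
  rw [LinearMap.smul_apply, LinearMap.smulRight_apply, smul_smul]

/-- Elements of the rational Burnside ring are determined by their marks. -/
theorem marks_injective [Finite H] {a b : RatBurnside H} (h : ∀ L, mark L a = mark L b) :
    a = b := by
  let := Fintype.ofFinite (Subgroup H)
  rw [← sub_eq_zero, eq_sum_stabCount (a - b)]
  refine Finset.sum_eq_zero fun L _ => ?_
  rw [stabCount_eq_zero (fun L => by rw [map_sub, h, sub_self]), mul_zero, zero_smul]

theorem mark_conjSub (h : H) (L : Subgroup H) (b : RatBurnside H) :
    mark (conjSub h L) b = mark L b := by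
  refine LinearMap.congr_fun (hom_ext fun X => ?_) b
  rw [mark_cls, mark_cls]
  refine congrArg Nat.cast (Nat.card_congr
    ((MulAction.toPerm h).subtypeEquiv fun x => ?_).symm)
  constructor
  · intro hx k hk
    have h₁ := hx _ (mem_conjSub.mp hk)
    have h₂ := congrArg (fun y => h • y) h₁
    simpa only [MulAction.toPerm_apply, smul_smul, mul_assoc, mul_inv_cancel_left] using h₂
  · intro hx k hk
    have h₁ := hx (h * k * h⁻¹) (mem_conjSub.mpr (by simpa [mul_assoc] using hk))
    rw [MulAction.toPerm_apply, smul_smul, inv_mul_cancel_right, mul_smul] at h₁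
    exact MulAction.injective h h₁

theorem le_of_mark_coset_ne_zero [Finite H] {K L : Subgroup H}
    (h : mark L (cls (FinGSet.coset K)) ≠ 0) : ∃ g : H, L ≤ conjSub g K := by
  rw [mark_cls, Nat.cast_ne_zero, Nat.card_ne_zero] at h
  obtain ⟨⟨x, hx⟩⟩ := h.1
  obtain ⟨g, hg⟩ := FinGSet.stabilizer_coset K x
  exact ⟨g, hg ▸ hx⟩

theorem mark_coset_self_ne_zero [Finite H] (K : Subgroup H) :
    mark K (cls (FinGSet.coset K)) ≠ 0 := by
  rw [mark_cls, Nat.cast_ne_zero, Nat.card_ne_zero]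
  refine ⟨⟨⟨QuotientGroup.mk 1, fun h hh => ?_⟩⟩, inferInstance⟩
  have h₁ := FinGSet.stabilizer_coset_mk K 1
  rw [conjSub_one] at h₁
  exact h₁.ge hh

/-- Every function on conjugacy classes of subgroups is the function of marks of an element of the
rational Burnside ring. -/
theorem exists_marks_eq [Finite H] (f : Subgroup H → ℚ)
    (hf : ∀ (h : H) (L : Subgroup H), f (conjSub h L) = f L) :
    ∃ e : RatBurnside H, ∀ L, mark L e = f L := by
  classical
  let := Fintype.ofFinite (Subgroup H)
  suffices hS : ∀ (n : ℕ) (S : Finset (Subgroup H)), S.card = n →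
      (∀ L ∈ S, ∀ (h : H) (L' : Subgroup H), L' ≤ conjSub h L → L' ∈ S) →
      ∀ f : Subgroup H → ℚ, (∀ (h : H) (L : Subgroup H), f (conjSub h L) = f L) →
      (∀ L, L ∉ S → f L = 0) → ∃ e : RatBurnside H, ∀ L, mark L e = f L from
    hS _ Finset.univ rfl (fun _ _ _ _ _ => Finset.mem_univ _) f hf
      (fun L hL => absurd (Finset.mem_univ L) hL)
  intro n
  induction n using Nat.strong_induction_on with
  | _ n ih =>
    intro S hn hclosed f hf hsupp
    rcases S.eq_empty_or_nonempty with rfl | hne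
    · exact ⟨0, fun L => by rw [map_zero, hsupp L (Finset.notMem_empty L)]⟩
    · obtain ⟨K, hK, hmax⟩ := S.exists_max_image (fun L => Nat.card L) hne
      let c : ℚ := f K / mark K (cls (FinGSet.coset K))
      let S' := S.filter fun L => ¬ ∃ h : H, L = conjSub h K
      have hlt : S'.card < n := by
        rw [← hn]
        refine Finset.card_lt_card (Finset.filter_ssubset.mpr ⟨K, hK, ?_⟩)
        exact not_not.mpr ⟨1, (conjSub_one K).symm⟩
      have hclosed' : ∀ L ∈ S', ∀ (h : H) (L' : Subgroup H), L' ≤ conjSub h L → L' ∈ S' := by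
        intro L hL h L' hL'
        obtain ⟨hLS, hLK⟩ := Finset.mem_filter.mp hL
        refine Finset.mem_filter.mpr ⟨hclosed L hLS h L' hL', ?_⟩
        rintro ⟨k, rfl⟩
        refine hLK ⟨h⁻¹ * k, ?_⟩
        have heq : conjSub k K = conjSub h L := by
          refine Subgroup.eq_of_le_of_card_ge hL' ?_
          rw [card_conjSub, card_conjSub]
          exact hmax L hLS
        rw [← conjSub_conjSub, heq, conjSub_conjSub, inv_mul_cancel, conjSub_one]
      have hsupp' : ∀ L, L ∉ S' → f L - c * mark L (cls (FinGSet.coset K)) = 0 := by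
        intro L hL
        by_cases hLS : L ∈ S
        · have : ∃ h : H, L = conjSub h K := by
            by_contra hcon
            exact hL (Finset.mem_filter.mpr ⟨hLS, hcon⟩)
          obtain ⟨h, rfl⟩ := this
          rw [hf, mark_conjSub, div_mul_cancel₀ _ (mark_coset_self_ne_zero K), sub_self]
        · have h₀ : mark L (cls (FinGSet.coset K)) = 0 := by
            by_contra hcon
            obtain ⟨g, hg⟩ := le_of_mark_coset_ne_zero hcon
            exact hLS (hclosed K hK g L hg)
          rw [hsupp L hLS, h₀, mul_zero, sub_zero]
      obtain ⟨e, he⟩ := ih _ hlt S' rfl hclosed'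
        (fun L => f L - c * mark L (cls (FinGSet.coset K)))
        (fun h L => by rw [hf, mark_conjSub]) hsupp'
      refine ⟨e + c • cls (FinGSet.coset K), fun L => ?_⟩
      rw [map_add, map_smul, he, smul_eq_mul, sub_add_cancel]

open Classical in
theorem exists_idem [Finite H] (K : Subgroup H) : ∃ e : RatBurnside H, ∀ L : Subgroup H,
    mark L e = if ∃ h : H, L = conjSub h K then 1 else 0 := by
  refine exists_marks_eq _ fun g L => if_congr ⟨?_, ?_⟩ rfl rfl
  · rintro ⟨h, hL⟩
    exact ⟨g⁻¹ * h, by rw [← conjSub_conjSub, ← hL, conjSub_conjSub, inv_mul_cancel, conjSub_one]⟩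
  · rintro ⟨h, rfl⟩
    exact ⟨g * h, conjSub_conjSub g h K⟩

/-- The idempotent `e_K^H` of the rational Burnside ring: the unique element with `|·^L| = 1` if
`L` is `H`-conjugate to `K` and `|·^L| = 0` otherwise. -/
noncomputable def idem [Finite H] (K : Subgroup H) : RatBurnside H := (exists_idem K).choose

open Classical in
theorem mark_idem [Finite H] (K L : Subgroup H) :
    mark L (idem K) = if ∃ h : H, L = conjSub h K then 1 else 0 :=
  (exists_idem K).choose_spec L

open Classical in
theorem idem_unique [Finite H] (K : Subgroup H) (b : RatBurnside H)
    (hb : ∀ L, mark L b = if ∃ h : H, L = conjSub h K then 1 else 0) : b = idem K :=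
  marks_injective fun L => by rw [hb, mark_idem]

end RatBurnside

/-! ### Rational Mackey functors -/

theorem inf_conjSub_eq {G : Type*} [Group G] (x : G) (K L : Subgroup G) :
    K ⊓ conjSub x L = conjSub x (L ⊓ conjSub x⁻¹ K) := by
  ext y
  simp only [Subgroup.mem_inf, mem_conjSub]
  constructor
  · rintro ⟨h₁, h₂⟩
    exact ⟨h₂, by simpa [mul_assoc] using h₁⟩
  · rintro ⟨h₁, h₂⟩
    exact ⟨by simpa [mul_assoc] using h₂, h₁⟩

/-- A rational `G`-Mackey functor. The value `M(G/H)` is `M.val H`; restriction `R^H_K`, induction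
`I^H_K` and conjugation `C_g : M(G/H) → M(G/gHg⁻¹)` are `M.res`, `M.ind` and `M.conj`. The target of
`C_g` is written as a subgroup `L` with a proof of `L = gHg⁻¹`. -/
structure RatMackeyFunctor (G : Type u) [Group G] [Finite G] where
  val : Subgroup G → Type v
  [addCommGroup : ∀ H, AddCommGroup (val H)]
  [module : ∀ H, Module ℚ (val H)]
  res : ∀ {K H : Subgroup G}, K ≤ H → (val H →ₗ[ℚ] val K)
  ind : ∀ {K H : Subgroup G}, K ≤ H → (val K →ₗ[ℚ] val H)
  conj : ∀ (g : G) {H L : Subgroup G}, L = conjSub g H → (val H →ₗ[ℚ] val L)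
  res_self : ∀ H : Subgroup G, res (le_refl H) = LinearMap.id
  ind_self : ∀ H : Subgroup G, ind (le_refl H) = LinearMap.id
  conj_self : ∀ (H : Subgroup G) (h : G) (hh : h ∈ H), conj h (conjSub_self hh) = LinearMap.id
  ind_trans : ∀ {L K H : Subgroup G} (hLK : L ≤ K) (hKH : K ≤ H),
    ind (hLK.trans hKH) = ind hKH ∘ₗ ind hLK
  res_trans : ∀ {L K H : Subgroup G} (hLK : L ≤ K) (hKH : K ≤ H),
    res (hLK.trans hKH) = res hLK ∘ₗ res hKH
  conj_mul : ∀ (g h : G) (H : Subgroup G),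
    conj (g * h) (conjSub_conjSub g h H) = conj g rfl ∘ₗ conj h rfl
  res_conj : ∀ (g : G) {K H : Subgroup G} (hKH : K ≤ H),
    res (conjSub_mono g hKH) ∘ₗ conj g rfl = conj g rfl ∘ₗ res hKH
  ind_conj : ∀ (g : G) {K H : Subgroup G} (hKH : K ≤ H),
    ind (conjSub_mono g hKH) ∘ₗ conj g rfl = conj g rfl ∘ₗ ind hKH
  /-- The Mackey axiom; the sum runs over representatives `x ∈ H` of the double cosets
  `K x L` in `H`. -/
  mackey : ∀ {K L H : Subgroup G} (hKH : K ≤ H) (hLH : L ≤ H),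
    res hKH ∘ₗ ind hLH =
      ∑ᶠ q : DoubleCoset.Quotient (K.subgroupOf H : Set H) (L.subgroupOf H : Set H),
        let x : G := ((Quotient.out q : H) : G)
        ind (inf_le_left : K ⊓ conjSub x L ≤ K) ∘ₗ
          conj x (inf_conjSub_eq x K L) ∘ₗ
            res (inf_le_left : L ⊓ conjSub x⁻¹ K ≤ L)

attribute [instance] RatMackeyFunctor.addCommGroup RatMackeyFunctor.module

namespace RatMackeyFunctor

section Weyl

variable {G : Type u} [Group G]

/-- The normalizer `N_H K`. -/
abbrev normIn (K H : Subgroup G) : Subgroup H := Subgroup.normalizer (K.subgroupOf H : Set H)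

/-- The Weyl group `W_H K = N_H K / K`. -/
abbrev Weyl (K H : Subgroup G) : Type u := normIn K H ⧸ (K.subgroupOf H).subgroupOf (normIn K H)

theorem eq_conjSub_of_mem_norm {K H : Subgroup G} (hKH : K ≤ H) (n : normIn K H) :
    K = conjSub ((n : H) : G) K := by
  have h := Subgroup.mem_normalizer_iff_map_conj_eq.mp n.2
  have h₁ : (conjSub (n : H) (K.subgroupOf H)).map H.subtype = K :=
    (congrArg (Subgroup.map H.subtype) h).trans (Subgroup.map_subgroupOf_eq_of_le hKH)
  have h₂ : (conjSub (n : H) (K.subgroupOf H)).map H.subtype =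
      conjSub ((n : H) : G) ((K.subgroupOf H).map H.subtype) := by
    rw [conjSub, conjSub, Subgroup.map_map, Subgroup.map_map]
    rfl
  rw [Subgroup.map_subgroupOf_eq_of_le hKH] at h₂
  exact h₁.symm.trans h₂

end Weyl

variable {G : Type u} [Group G] [Finite G] (M : RatMackeyFunctor.{u, v} G)

theorem conj_comp (g h : G) {H L N : Subgroup G} (hL : L = conjSub h H) (hN : N = conjSub g L)
    (hN' : N = conjSub (g * h) H) : M.conj (g * h) hN' = M.conj g hN ∘ₗ M.conj h hL := by
  subst hL
  subst hN
  exact M.conj_mul g h H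

/-- The operator `I^H_L ∘ R^H_L` on `M(G/H)`, for `L` a subgroup of `H`. -/
def indRes (H : Subgroup G) (L : Subgroup H) : Module.End ℚ (M.val H) :=
  M.ind (Subgroup.map_subtype_le L) ∘ₗ M.res (Subgroup.map_subtype_le L)

theorem res_comp_conj (g : G) {K H K' H' : Subgroup G} (hK : K' = conjSub g K)
    (hH : H' = conjSub g H) (hKH : K ≤ H) (hKH' : K' ≤ H') :
    M.res hKH' ∘ₗ M.conj g hH = M.conj g hK ∘ₗ M.res hKH := by
  subst hK
  subst hH
  exact M.res_conj g hKH

theorem ind_comp_conj (g : G) {K H K' H' : Subgroup G} (hK : K' = conjSub g K)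
    (hH : H' = conjSub g H) (hKH : K ≤ H) (hKH' : K' ≤ H') :
    M.ind hKH' ∘ₗ M.conj g hK = M.conj g hH ∘ₗ M.ind hKH := by
  subst hK
  subst hH
  exact M.ind_conj g hKH

/-- The operator `I^H_L ∘ R^H_L` only depends on the `H`-conjugacy class of `L`. -/
theorem indRes_conjSub (H : Subgroup G) (h : H) (L : Subgroup H) :
    M.indRes H (conjSub h L) = M.indRes H L := by
  have hL : (conjSub h L).map H.subtype = conjSub (h : G) (L.map H.subtype) := by
    rw [conjSub, conjSub, Subgroup.map_map, Subgroup.map_map]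
    rfl
  have h₁ := M.res_comp_conj (h : G) hL (conjSub_self h.2) (Subgroup.map_subtype_le L)
    (Subgroup.map_subtype_le _)
  have h₂ := M.ind_comp_conj (h : G) hL (conjSub_self h.2) (Subgroup.map_subtype_le L)
    (Subgroup.map_subtype_le _)
  rw [M.conj_self H h h.2, LinearMap.comp_id] at h₁
  rw [M.conj_self H h h.2, LinearMap.id_comp] at h₂
  rw [indRes, indRes, h₁, ← LinearMap.comp_assoc, h₂]

/-- The action of the rational Burnside ring `A_ℚ(H)` on `M(G/H)`: the linear map with
`[H/L] ↦ I^H_L ∘ R^H_L`, see `burnsideAct_coset` and `RatBurnside.hom_ext_coset`. -/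
noncomputable def burnsideAct (H : Subgroup G) : RatBurnside H →ₗ[ℚ] Module.End ℚ (M.val H) :=
  RatBurnside.liftAdditive (FinGSet.orbitSum (M.indRes H))
    (FinGSet.orbitSum_iso _) (FinGSet.orbitSum_sum _)

theorem burnsideAct_coset (H : Subgroup G) (L : Subgroup H) :
    M.burnsideAct H (RatBurnside.cls (FinGSet.coset L)) = M.indRes H L := by
  rw [burnsideAct, RatBurnside.liftAdditive_cls]
  exact FinGSet.orbitSum_coset _ (M.indRes_conjSub H) L

/-- The summand `e_K^H M(G/H)` of `M(G/H)`, for `K ≤ H`. -/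
noncomputable def idemPart {K H : Subgroup G} (_hKH : K ≤ H) : Submodule ℚ (M.val H) :=
  LinearMap.range (M.burnsideAct H (RatBurnside.idem (K.subgroupOf H)))

/-- The action of `W_H K` on `M(G/K)` by conjugation maps. -/
noncomputable def weylRep {K H : Subgroup G} (hKH : K ≤ H) :
    Representation ℚ (Weyl K H) (M.val K) :=
  QuotientGroup.lift _
    { toFun := fun n => M.conj ((n : H) : G) (eq_conjSub_of_mem_norm hKH n)
      map_one' := M.conj_self K 1 K.one_mem
      map_mul' := fun n m => M.conj_comp _ _ _ _ _ }
    (by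
      intro n hn
      exact M.conj_self K _ hn)

/-- The fixed points `(e_K^K M(G/K))^{W_H K}`: the elements of `e_K^K M(G/K)` that are fixed by the
action of `W_H K` on `M(G/K)`. -/
noncomputable def idemFixed {K H : Subgroup G} (hKH : K ≤ H) : Submodule ℚ (M.val K) :=
  M.idemPart (le_refl K) ⊓ (M.weylRep hKH).invariants

end RatMackeyFunctor

/-! Write R, I for restriction and induction between K ≤ H. Both composites of R and I are nonzero
scalars on the two spaces in question, and over ℚ this makes R bijective.

The action of A_ℚ(H) on M(G/H) is multiplicative and compatible with restriction: R (b · x) = (b|_K)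
· R x (`res_comp_burnsideAct`, `burnsideAct_mul`). Compatibility with restriction is the Mackey
axiom applied to R I_L R_L, since double cosets K\H/L are the K-orbits on H/L. Multiplicativity
follows from it by a Frobenius reciprocity argument (`burnsideAct_coset_mul`).

As marks determine elements of A_ℚ, comparing marks gives e_K^H|_K = e_K^K, [H/K] · e_K^H =
|(H/K)^K| · e_K^H, and e_K^K|_L = 0 for L < K. The first shows that R maps the one space into the
other. The second makes I R the nonzero scalar |(H/K)^K| on e_K^H M(G/H). By the third, in the
Mackey formula for R I y with y in e_K^K M(G/K) only the double cosets of elements normalizing K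
survive; each contributes y when y is fixed by W_H K, so R I y is a positive multiple of y. -/

/-! ### Restriction of finite `H`-sets and orbit sums -/

namespace FinGSet

variable {H K : Type u} [Group H] [Group K]

/-- The `K`-set obtained from an `H`-set along a homomorphism `K → H`. -/
def restrict (f : K →* H) (X : FinGSet H) : FinGSet K where
  carrier := X.carrier
  action := MulAction.compHom _ f

theorem stabilizer_restrict (f : K →* H) (X : FinGSet H) (x : X.carrier) :
    MulAction.stabilizer K (α := (X.restrict f).carrier) x =
      (MulAction.stabilizer H x).comap f := rfl

theorem restrict_iso (f : K →* H) {X Y : FinGSet H} (h : Iso X Y) :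
    Iso (X.restrict f) (Y.restrict f) := by
  obtain ⟨e, he⟩ := h
  exact ⟨e, fun k x => he (f k) x⟩

theorem restrict_sum_iso (f : K →* H) (X Y : FinGSet H) :
    Iso ((X.sum Y).restrict f) ((X.restrict f).sum (Y.restrict f)) := by
  refine ⟨Equiv.refl _, ?_⟩
  rintro k (x | y) <;> rfl

theorem stabilizer_prod (X Y : FinGSet H) (x : X.carrier) (y : Y.carrier) :
    MulAction.stabilizer H ((x, y) : (X.prod Y).carrier) =
      MulAction.stabilizer H x ⊓ MulAction.stabilizer H y := by
  ext h
  exact Prod.ext_iff (x := ((h • x, h • y) : X.carrier × Y.carrier)) (y := (x, y))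

/-- The orbit sum computed with a system of representatives of the orbits. -/
theorem orbitSum_eq_sum_repr [Finite H] {V : Type*} [AddCommGroup V] [Module ℚ V]
    (φ : Subgroup H → V) (hφ : ∀ (h : H) (L : Subgroup H), φ (conjSub h L) = φ L)
    (X : FinGSet H) {Q : Type*} (r : Q → X.carrier)
    (hinj : ∀ q q', r q ∈ MulAction.orbit H (r q') → q = q')
    (hsurj : ∀ x, ∃ q, x ∈ MulAction.orbit H (r q)) :
    orbitSum φ X = ∑ᶠ q, φ (MulAction.stabilizer H (r q)) := by
  classical
  let := Fintype.ofFinite X.carrier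
  have : Finite Q := Finite.of_injective r fun q q' h =>
    hinj q q' (h ▸ MulAction.mem_orbit_self _)
  let := Fintype.ofFinite Q
  choose p hp using hsurj
  rw [orbitSum, finsum_eq_sum_of_fintype, finsum_eq_sum_of_fintype,
    ← Finset.sum_fiberwise Finset.univ p]
  refine Finset.sum_congr rfl fun q _ => ?_
  -- The fibre of `p` over `q` is the orbit of `r q`, on which the summand is constant because
  -- stabilizers are conjugate; by orbit-stabilizer the weights on one orbit add up to 1.
  have hterm : ∀ x ∈ Finset.univ.filter (fun x => p x = q),
      ((Nat.card (MulAction.stabilizer H x) : ℚ) / Nat.card H) • φ (MulAction.stabilizer H x) =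
        ((Nat.card (MulAction.stabilizer H (r q)) : ℚ) / Nat.card H) •
          φ (MulAction.stabilizer H (r q)) := by
    intro x hx
    obtain ⟨h, hh⟩ := (Finset.mem_filter.mp hx).2 ▸ hp x
    have hs : MulAction.stabilizer H x = conjSub h (MulAction.stabilizer H (r q)) := by
      rw [← hh]
      exact MulAction.stabilizer_smul_eq_stabilizer_map_conj h (r q)
    rw [hs, hφ, card_conjSub]
  have hcard : (Finset.univ.filter (fun x => p x = q)).card =
      Nat.card (MulAction.orbit H (r q)) := by
    rw [Nat.card_coe_set_eq, ← Set.ncard_coe_finset]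
    congr 1
    ext x
    simp only [Finset.coe_filter, Finset.mem_univ, true_and, Set.mem_ofPred_eq]
    constructor
    · rintro rfl
      exact hp x
    · intro hx
      refine hinj _ _ ?_
      rw [← MulAction.orbit_eq_iff.mpr hx]
      exact MulAction.mem_orbit_symm.mp (hp x)
  rw [Finset.sum_congr rfl hterm, Finset.sum_const, hcard, ← Nat.cast_smul_eq_nsmul ℚ, smul_smul,
    ← mul_div_assoc]
  have hc : (Nat.card (MulAction.orbit H (r q)) : ℚ) * Nat.card (MulAction.stabilizer H (r q)) =
      Nat.card H := by
    rw [← Nat.cast_mul, ← Nat.card_prod,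
      Nat.card_congr (MulAction.orbitProdStabilizerEquivGroup H (r q))]
  rw [hc, div_self (by exact_mod_cast Nat.card_pos.ne'), one_smul]

/-- The orbit sum on `H / L × X`, in terms of the restriction of `X` to `L`. -/
theorem orbitSum_coset_prod [Finite H] {V : Type*} [AddCommGroup V] [Module ℚ V]
    (φ : Subgroup H → V) (hφ : ∀ (h : H) (L : Subgroup H), φ (conjSub h L) = φ L)
    (L : Subgroup H) (X : FinGSet H) :
    orbitSum φ ((coset L).prod X) =
      ∑ᶠ x : X.carrier, ((Nat.card ↥(L ⊓ MulAction.stabilizer H x) : ℚ) / Nat.card L) •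
        φ (L ⊓ MulAction.stabilizer H x) := by
  let : Fintype X.carrier := Fintype.ofFinite _
  let : Fintype (coset L).carrier := Fintype.ofFinite _
  let : Fintype ((coset L).prod X).carrier :=
    inferInstanceAs (Fintype ((coset L).carrier × X.carrier))
  rw [orbitSum, finsum_eq_sum_of_fintype, finsum_eq_sum_of_fintype]
  refine (Fintype.sum_prod_type _).trans ?_
  have hterm : ∀ a : (coset L).carrier,
      (∑ x : X.carrier, ((Nat.card (MulAction.stabilizer H
        ((a, x) : ((coset L).prod X).carrier)) : ℚ) / Nat.card H) •
          φ (MulAction.stabilizer H ((a, x) : ((coset L).prod X).carrier))) =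
      ∑ x : X.carrier, ((Nat.card ↥(L ⊓ MulAction.stabilizer H x) : ℚ) / Nat.card H) •
        φ (L ⊓ MulAction.stabilizer H x) := by
    intro a
    obtain ⟨h, rfl⟩ := QuotientGroup.mk_surjective (s := L) a
    -- Replacing x by h • x makes the stabilizer of (hL, h • x) the conjugate by h of L ∩ H_x. So
    -- every coset contributes the same sum, and the number |H| / |L| of cosets turns the weight
    -- 1/|H| into 1/|L|.
    rw [← Equiv.sum_comp (MulAction.toPerm h : Equiv.Perm X.carrier)]
    refine Finset.sum_congr rfl fun x _ => ?_
    have hs : MulAction.stabilizer H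
        ((QuotientGroup.mk h, MulAction.toPerm h x) : ((coset L).prod X).carrier) =
          conjSub h (L ⊓ MulAction.stabilizer H x) := by
      refine (stabilizer_prod (coset L) X _ _).trans ?_
      rw [conjSub, Subgroup.map_inf _ _ _ (MulAut.conj h).injective]
      exact congrArg₂ _ (stabilizer_coset_mk L h)
        (MulAction.stabilizer_smul_eq_stabilizer_map_conj h x)
    rw [hs, hφ, card_conjSub]
  refine (Finset.sum_congr rfl fun a _ => hterm a).trans ?_
  rw [Finset.sum_const, Finset.card_univ, ← Nat.card_eq_fintype_card, Finset.smul_sum]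
  refine Finset.sum_congr rfl fun x _ => ?_
  rw [← Nat.cast_smul_eq_nsmul ℚ, smul_smul]
  congr 1
  have hc : (Nat.card (coset L).carrier : ℚ) * Nat.card L = Nat.card H := by
    have := L.card_eq_card_quotient_mul_card_subgroup
    exact_mod_cast this.symm
  have hL : (Nat.card L : ℚ) ≠ 0 := by exact_mod_cast Nat.card_pos.ne'
  have hH : (Nat.card H : ℚ) ≠ 0 := by exact_mod_cast Nat.card_pos.ne'
  rw [← mul_div_assoc, div_eq_div_iff hH hL, ← hc]
  ring

end FinGSet

/-! ### Marks under restriction and products, and identities for the idempotents -/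

namespace RatBurnside

variable {H K : Type u} [Group H] [Group K]

/-- The restriction map of rational Burnside rings along a homomorphism `K → H`. -/
noncomputable def restrict (f : K →* H) : RatBurnside H →ₗ[ℚ] RatBurnside K :=
  liftAdditive (fun X => cls (X.restrict f)) (fun _ _ h => cls_iso (FinGSet.restrict_iso f h))
    (fun X Y => by rw [cls_iso (FinGSet.restrict_sum_iso f X Y), cls_sum])

theorem restrict_cls (f : K →* H) (X : FinGSet H) : restrict f (cls X) = cls (X.restrict f) :=
  liftAdditive_cls _ _ _ X

/-- A point is fixed by L acting through f exactly when its stabilizer contains the image of L. -/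
theorem mark_restrict (f : K →* H) (L : Subgroup K) (b : RatBurnside H) :
    mark L (restrict f b) = mark (L.map f) b := by
  refine LinearMap.congr_fun (f := mark L ∘ₗ restrict f) (hom_ext fun X => ?_) b
  rw [LinearMap.comp_apply, restrict_cls, mark_cls, mark_cls]
  refine congrArg Nat.cast (Nat.card_congr (Equiv.subtypeEquivRight fun x => ?_))
  exact Subgroup.map_le_iff_le_comap (K := L) (H := MulAction.stabilizer (α := X.carrier) H x) |>.symm

/-- The fixed points of a product are the product of the fixed points; linearity in each factor
separately extends this from classes of sets to the whole ring. -/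
theorem mark_mul (L : Subgroup H) (a b : RatBurnside H) :
    mark L (a * b) = mark L a * mark L b := by
  have h : ∀ X b, mark L (cls X * b) = mark L (cls X) * mark L b := by
    intro X b
    refine LinearMap.congr_fun (f := mark L ∘ₗ LinearMap.mulLeft ℚ (cls X))
      (g := mark L (cls X) • mark L) (hom_ext fun Y => ?_) b
    rw [LinearMap.comp_apply, LinearMap.mulLeft_apply, LinearMap.smul_apply, smul_eq_mul,
      ← cls_prod, mark_cls, mark_cls, mark_cls, ← Nat.cast_mul, ← Nat.card_prod]
    refine congrArg Nat.cast (Nat.card_congr (Equiv.trans (Equiv.subtypeEquivRight fun x => ?_)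
      Equiv.subtypeProdEquivProd))
    have := FinGSet.stabilizer_prod X Y x.1 x.2
    change L ≤ MulAction.stabilizer H ((x.1, x.2) : (X.prod Y).carrier) ↔
      L ≤ MulAction.stabilizer H x.1 ∧ L ≤ MulAction.stabilizer H x.2
    rw [this, le_inf_iff]
  refine LinearMap.congr_fun (f := mark L ∘ₗ LinearMap.mulRight ℚ b)
      (g := mark L b • mark L) (hom_ext fun X => ?_) a |>.trans (mul_comm _ _)
  exact (h X b).trans (mul_comm _ _)

theorem idem_mul_idem [Finite H] (K : Subgroup H) : idem K * idem K = idem K := by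
  classical
  refine idem_unique K _ fun L => ?_
  rw [mark_mul, mark_idem]
  split_ifs <;> norm_num

/-- Marks are constant on conjugacy classes, so multiplying by any element only rescales the
indicator function of the class of K. -/
theorem coset_mul_idem [Finite H] (K : Subgroup H) :
    cls (FinGSet.coset K) * idem K = mark K (cls (FinGSet.coset K)) • idem K := by
  classical
  refine marks_injective fun L => ?_
  rw [mark_mul, map_smul, mark_idem, smul_eq_mul]
  split_ifs with h
  · obtain ⟨h, rfl⟩ := h
    rw [mark_conjSub]
  · rw [mul_zero, mul_zero]

/-- A subgroup of K that is conjugate to K in H has the order of K, hence is K. So both sides have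
as marks the indicator function of the full subgroup `K.subgroupOf K = ⊤`. -/
theorem restrict_idem {G : Type u} [Group G] [Finite G] {K H : Subgroup G} (hKH : K ≤ H) :
    restrict (Subgroup.inclusion hKH) (idem (K.subgroupOf H)) =
      idem (K.subgroupOf K) := by
  classical
  refine idem_unique _ _ fun L => ?_
  rw [mark_restrict, mark_idem]
  refine if_congr ?_ rfl rfl
  have hK : (⊤ : Subgroup K).map (Subgroup.inclusion hKH) = K.subgroupOf H := by
    rw [← MonoidHom.range_eq_map, Subgroup.inclusion_range]
  have hcard : Nat.card (K.subgroupOf H) = Nat.card K := by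
    rw [← hK, Subgroup.card_map_of_injective (Subgroup.inclusion_injective hKH), Subgroup.card_top]
  constructor
  · rintro ⟨h, hh⟩
    refine ⟨1, ?_⟩
    rw [conjSub_one, Subgroup.subgroupOf_self]
    refine Subgroup.eq_top_of_card_eq _ ?_
    rw [← hcard, ← card_conjSub h, ← hh,
      Subgroup.card_map_of_injective (Subgroup.inclusion_injective hKH)]
  · rintro ⟨k, rfl⟩
    refine ⟨1, ?_⟩
    rw [conjSub_one, ← hK, Subgroup.subgroupOf_self, ← conjSub_self (Subgroup.mem_top k)]

end RatBurnside

/-! ### Composition with finite sums of linear maps -/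

namespace LinearMap

variable {R ι U V W : Type*} [CommSemiring R] [AddCommMonoid U] [AddCommMonoid V] [AddCommMonoid W]
  [Module R U] [Module R V] [Module R W]

theorem sum_comp_eq (s : Finset ι) (f : ι → V →ₗ[R] W) (g : U →ₗ[R] V) :
    (∑ i ∈ s, f i) ∘ₗ g = ∑ i ∈ s, f i ∘ₗ g := by
  ext x
  simp only [comp_apply, sum_apply]

theorem comp_sum_eq (s : Finset ι) (f : V →ₗ[R] W) (g : ι → U →ₗ[R] V) :
    f ∘ₗ (∑ i ∈ s, g i) = ∑ i ∈ s, f ∘ₗ g i := by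
  ext x
  simp only [comp_apply, sum_apply, map_sum]

end LinearMap

/-! ### The Burnside ring action: restriction and multiplicativity -/

namespace RatMackeyFunctor

variable {G : Type u} [Group G] [Finite G] (M : RatMackeyFunctor.{u, v} G)

/-- Frees the intermediate subgroup of G from its presentation as an image, so that operators
arising from different ambient groups can be compared. -/
theorem indRes_eq {K N : Subgroup G} (S : Subgroup K) (hN : N = S.map K.subtype) (hNK : N ≤ K) :
    M.indRes K S = M.ind hNK ∘ₗ M.res hNK := by
  subst hN
  rfl

/-- Conjugation commutes with restriction, and elements of H act trivially on M(G/H). -/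
theorem conj_comp_res {H N N' : Subgroup G} {x : G} (hx : x ∈ H) (hN : N' = conjSub x N)
    (hNH : N ≤ H) (hNH' : N' ≤ H) : M.conj x hN ∘ₗ M.res hNH = M.res hNH' := by
  rw [← M.res_comp_conj x hN (conjSub_self hx) hNH hNH', M.conj_self H x hx, LinearMap.comp_id]

/-- The double cosets K\H/L index the K-orbits on H/L, and xL has stabilizer K ∩ xLx⁻¹ in K.
Precomposed with restriction from H, the Mackey summand of x loses its conjugation and becomes
induction after restriction for that stabilizer. -/
theorem res_comp_indRes {K L H : Subgroup G} (hKH : K ≤ H) (hLH : L ≤ H) :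
    M.res hKH ∘ₗ M.indRes H (L.subgroupOf H) =
      FinGSet.orbitSum (M.indRes K)
        ((FinGSet.coset (L.subgroupOf H)).restrict (Subgroup.inclusion hKH)) ∘ₗ M.res hKH := by
  let Q := DoubleCoset.Quotient (K.subgroupOf H : Set H) (L.subgroupOf H : Set H)
  have : Finite Q := Quotient.finite _
  let := Fintype.ofFinite Q
  rw [FinGSet.orbitSum_eq_sum_repr (M.indRes K) (M.indRes_conjSub K)
    ((FinGSet.coset (L.subgroupOf H)).restrict (Subgroup.inclusion hKH))
    (fun q : Q => (QuotientGroup.mk (Quotient.out q) : H ⧸ L.subgroupOf H)) ?_ ?_,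
    M.indRes_eq _ (Subgroup.map_subgroupOf_eq_of_le hLH).symm hLH, ← LinearMap.comp_assoc,
    M.mackey hKH hLH, finsum_eq_sum_of_fintype, finsum_eq_sum_of_fintype, LinearMap.sum_comp_eq,
    LinearMap.sum_comp_eq]
  · refine Finset.sum_congr rfl fun q _ => ?_
    have hs : K ⊓ conjSub ((Quotient.out q : H) : G) L = (MulAction.stabilizer K
        (α := ((FinGSet.coset (L.subgroupOf H)).restrict (Subgroup.inclusion hKH)).carrier)
        (QuotientGroup.mk (Quotient.out q) : H ⧸ L.subgroupOf H)).map K.subtype := by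
      have h₁ := (FinGSet.stabilizer_restrict (Subgroup.inclusion hKH)
        (FinGSet.coset (L.subgroupOf H))
        (QuotientGroup.mk (Quotient.out q) : H ⧸ L.subgroupOf H)).trans
        (congrArg _ (FinGSet.stabilizer_coset_mk (L.subgroupOf H) (Quotient.out q)))
      refine Eq.trans ?_ (congrArg (Subgroup.map K.subtype) h₁).symm
      ext y
      simp only [Subgroup.mem_inf, mem_conjSub, Subgroup.mem_map, Subgroup.mem_comap,
        Subgroup.mem_subgroupOf, Subgroup.coe_subtype]
      constructor
      · rintro ⟨hy, hy'⟩
        exact ⟨⟨y, hy⟩, hy', rfl⟩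
      · rintro ⟨z, hz, rfl⟩
        exact ⟨z.2, hz⟩
    -- All restrictions are merged into single ones starting at H, where `conj_comp_res` absorbs C_x
    -- because x lies in H.
    rw [M.indRes_eq _ hs inf_le_left, LinearMap.comp_assoc, LinearMap.comp_assoc,
      LinearMap.comp_assoc, ← M.res_trans, ← M.res_trans,
      M.conj_comp_res (Quotient.out q : H).2 _ _ (inf_le_left.trans hKH)]
  -- The chosen double coset representatives meet each K-orbit on H/L at most once, and by the next
  -- goal at least once.
  · rintro q q' ⟨k, hk⟩
    have hk' : (QuotientGroup.mk (Subgroup.inclusion hKH k * Quotient.out q') :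
      H ⧸ L.subgroupOf H) = QuotientGroup.mk (Quotient.out q) := hk
    rw [QuotientGroup.eq] at hk'
    rw [← DoubleCoset.out_eq' _ _ q, ← DoubleCoset.out_eq' _ _ q']
    refine ((DoubleCoset.eq _ _ _ _).mpr ⟨Subgroup.inclusion hKH k, k.2, _, hk', ?_⟩).symm
    rw [mul_inv_cancel_left]
  · intro x
    obtain ⟨h, rfl⟩ := QuotientGroup.mk_surjective (s := L.subgroupOf H) x
    obtain ⟨k, l, hk, hl, he⟩ := DoubleCoset.mk_out_eq_mul (K.subgroupOf H) (L.subgroupOf H) h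
    refine ⟨DoubleCoset.mk _ _ h, MulAction.mem_orbit_symm.mp ⟨⟨(k : G), hk⟩, ?_⟩⟩
    change (QuotientGroup.mk (k * h) : H ⧸ L.subgroupOf H) = QuotientGroup.mk (Quotient.out _)
    refine QuotientGroup.eq.mpr ?_
    rw [he, inv_mul_cancel_left]
    exact hl

/-- The action of the rational Burnside rings is compatible with restriction. -/
theorem res_comp_burnsideAct {K H : Subgroup G} (hKH : K ≤ H) (b : RatBurnside H) :
    M.res hKH ∘ₗ M.burnsideAct H b =
      M.burnsideAct K (RatBurnside.restrict (Subgroup.inclusion hKH) b) ∘ₗ M.res hKH := by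
  refine LinearMap.congr_fun
    (f := (LinearMap.llcomp ℚ _ _ _ (M.res hKH)) ∘ₗ M.burnsideAct H)
    (g := LinearMap.lcomp ℚ _ (M.res hKH) ∘ₗ M.burnsideAct K ∘ₗ
      RatBurnside.restrict (Subgroup.inclusion hKH))
    (RatBurnside.hom_ext_coset fun L => ?_) b
  have hL : L = (L.map H.subtype).subgroupOf H :=
    (Subgroup.comap_map_eq_self_of_injective H.subtype_injective L).symm
  change M.res hKH ∘ₗ M.burnsideAct H _ = M.burnsideAct K (RatBurnside.restrict _ _) ∘ₗ M.res hKH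
  rw [burnsideAct_coset, RatBurnside.restrict_cls, hL,
    M.res_comp_indRes hKH (Subgroup.map_subtype_le L), burnsideAct, RatBurnside.liftAdditive_cls]

/-- Moving b past the restriction leaves I_L (b|_L) R_L. For b = [X] this is the action of [H/L ×
X]: the H-orbits on H/L × X correspond to the L-orbits on X, with stabilizers L ∩ H_x, and induction
and restriction through L are transitive. -/
theorem burnsideAct_coset_mul (H : Subgroup G) (L : Subgroup H) (b : RatBurnside H) :
    M.burnsideAct H (RatBurnside.cls (FinGSet.coset L) * b) =
      M.indRes H L ∘ₗ M.burnsideAct H b := by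
  have hLH := Subgroup.map_subtype_le L
  rw [indRes, LinearMap.comp_assoc, M.res_comp_burnsideAct]
  refine LinearMap.congr_fun
    (f := M.burnsideAct H ∘ₗ LinearMap.mulLeft ℚ (RatBurnside.cls (H := H) (FinGSet.coset L)))
    (g := (LinearMap.llcomp ℚ _ _ _ (M.ind hLH)) ∘ₗ
      LinearMap.lcomp ℚ (M.val (L.map H.subtype)) (M.res hLH) ∘ₗ
      M.burnsideAct (L.map H.subtype) ∘ₗ RatBurnside.restrict (Subgroup.inclusion hLH))
    (RatBurnside.hom_ext fun X => ?_) b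
  change M.burnsideAct H (RatBurnside.cls (FinGSet.coset L) * RatBurnside.cls X) =
    M.ind hLH ∘ₗ M.burnsideAct (L.map H.subtype) (RatBurnside.restrict
      (Subgroup.inclusion hLH) (RatBurnside.cls X)) ∘ₗ M.res hLH
  let := Fintype.ofFinite X.carrier
  let : Fintype (X.restrict (Subgroup.inclusion hLH)).carrier :=
    inferInstanceAs (Fintype X.carrier)
  rw [← RatBurnside.cls_prod, RatBurnside.restrict_cls, burnsideAct, burnsideAct,
    RatBurnside.liftAdditive_cls, RatBurnside.liftAdditive_cls,
    FinGSet.orbitSum_coset_prod _ (M.indRes_conjSub H), FinGSet.orbitSum,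
    finsum_eq_sum_of_fintype, finsum_eq_sum_of_fintype, LinearMap.sum_comp_eq, LinearMap.comp_sum_eq]
  refine Finset.sum_congr rfl fun (x : X.carrier) _ => ?_
  set S := MulAction.stabilizer ↥(L.map H.subtype)
    (α := (X.restrict (Subgroup.inclusion hLH)).carrier) x with hS
  -- L ∩ H_x, formed in H, and the stabilizer of x in L are the same subgroup of G.
  have hmap : (L ⊓ MulAction.stabilizer H x).map H.subtype = S.map (L.map H.subtype).subtype := by
    rw [hS, FinGSet.stabilizer_restrict]
    ext y
    simp only [Subgroup.mem_inf, Subgroup.mem_map, Subgroup.mem_comap, Subgroup.coe_subtype]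
    constructor
    · rintro ⟨z, ⟨hz, hz'⟩, rfl⟩
      exact ⟨⟨z, z, hz, rfl⟩, hz', rfl⟩
    · rintro ⟨⟨_, z, hz, rfl⟩, hz', rfl⟩
      exact ⟨z, ⟨hz, hz'⟩, rfl⟩
  have hcard : Nat.card ↥(L ⊓ MulAction.stabilizer H x) = Nat.card S := by
    rw [← Subgroup.card_map_of_injective H.subtype_injective, hmap,
      Subgroup.card_map_of_injective (Subgroup.subtype_injective _)]
  rw [hcard, Subgroup.card_map_of_injective H.subtype_injective, LinearMap.smul_comp,
    LinearMap.comp_smul, M.indRes_eq _ hmap.symm ((Subgroup.map_subtype_le S).trans hLH),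
    M.indRes_eq S rfl (Subgroup.map_subtype_le S), M.ind_trans (Subgroup.map_subtype_le S) hLH,
    M.res_trans (Subgroup.map_subtype_le S) hLH]
  rfl

/-- The action of the rational Burnside ring is multiplicative. -/
theorem burnsideAct_mul (H : Subgroup G) (a b : RatBurnside H) :
    M.burnsideAct H (a * b) = M.burnsideAct H a ∘ₗ M.burnsideAct H b := by
  refine LinearMap.congr_fun (f := M.burnsideAct H ∘ₗ LinearMap.mulRight ℚ b)
    (g := LinearMap.lcomp ℚ _ (M.burnsideAct H b) ∘ₗ M.burnsideAct H)
    (RatBurnside.hom_ext_coset fun L => ?_) a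
  change M.burnsideAct H (_ * b) = M.burnsideAct H _ ∘ₗ M.burnsideAct H b
  rw [burnsideAct_coset_mul, burnsideAct_coset]

/-! ### Restriction and induction on the idempotent summands -/

theorem burnsideAct_idem_of_mem {K H : Subgroup G} (hKH : K ≤ H) {x : M.val H}
    (hx : x ∈ M.idemPart hKH) :
    M.burnsideAct H (RatBurnside.idem (K.subgroupOf H)) x = x := by
  obtain ⟨z, rfl⟩ := hx
  rw [← LinearMap.comp_apply, ← burnsideAct_mul, RatBurnside.idem_mul_idem]

theorem burnsideAct_idem_mem {K H : Subgroup G} (hKH : K ≤ H) (x : M.val H) :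
    M.burnsideAct H (RatBurnside.idem (K.subgroupOf H)) x ∈ M.idemPart hKH :=
  LinearMap.mem_range_self _ x

/-- The idempotent e_K^K restricts to zero on L: a subgroup of L is too small to be K, so all marks
vanish. -/
theorem res_eq_zero_of_mem {K L : Subgroup G} (hLK : L < K) {y : M.val K}
    (hy : y ∈ M.idemPart (le_refl K)) : M.res hLK.le y = 0 := by
  classical
  obtain ⟨z, rfl⟩ := hy
  have h : RatBurnside.restrict (Subgroup.inclusion hLK.le)
      (RatBurnside.idem (K.subgroupOf K)) = 0 := by
    refine RatBurnside.marks_injective fun P => ?_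
    rw [RatBurnside.mark_restrict, RatBurnside.mark_idem, map_zero, if_neg]
    rintro ⟨h, hh⟩
    have h₁ := congrArg (fun S : Subgroup K => Nat.card S) hh
    simp only [card_conjSub, Subgroup.subgroupOf_self, Subgroup.card_top,
      Subgroup.card_map_of_injective (Subgroup.inclusion_injective hLK.le)] at h₁
    have h₂ := Subgroup.card_le_card_group P
    exact hLK.ne (Subgroup.eq_of_le_of_card_ge hLK.le (h₁ ▸ h₂))
  rw [← LinearMap.comp_apply, M.res_comp_burnsideAct, h, map_zero, LinearMap.zero_comp,
    LinearMap.zero_apply]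

/-- Membership in the summand holds because e_K^H restricts to e_K^K; invariance holds because the
normalizing elements lie in H and so act trivially on restrictions from H. -/
theorem res_mem_idemFixed {K H : Subgroup G} (hKH : K ≤ H) {x : M.val H}
    (hx : x ∈ M.idemPart hKH) : M.res hKH x ∈ M.idemFixed hKH := by
  constructor
  · rw [← M.burnsideAct_idem_of_mem hKH hx, ← LinearMap.comp_apply, M.res_comp_burnsideAct,
      RatBurnside.restrict_idem]
    exact M.burnsideAct_idem_mem (le_refl K) _
  · rintro ⟨n⟩
    exact LinearMap.congr_fun (M.conj_comp_res (n : H).2 (eq_conjSub_of_mem_norm hKH n) hKH hKH) x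

/-- On `e_K^H M(G/H)`, the operator `I^H_K ∘ R^H_K` is a nonzero scalar. -/
theorem ind_res_of_mem {K H : Subgroup G} (hKH : K ≤ H) {x : M.val H}
    (hx : x ∈ M.idemPart hKH) : M.ind hKH (M.res hKH x) =
      RatBurnside.mark (K.subgroupOf H) (RatBurnside.cls (FinGSet.coset (K.subgroupOf H))) • x := by
  -- The operator is the action of [H/K], and [H/K] multiplies e_K^H by its mark at K.
  have h := M.burnsideAct_mul H (RatBurnside.cls (FinGSet.coset (K.subgroupOf H)))
    (RatBurnside.idem (K.subgroupOf H))
  rw [RatBurnside.coset_mul_idem, map_smul, burnsideAct_coset,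
    M.indRes_eq _ (Subgroup.map_subgroupOf_eq_of_le hKH).symm hKH] at h
  have h' := LinearMap.congr_fun h x
  simp only [LinearMap.smul_apply, LinearMap.comp_apply, M.burnsideAct_idem_of_mem hKH hx] at h'
  exact h'.symm

/-- On `(e_K^K M(G/K))^{W_H K}`, the operator `R^H_K ∘ I^H_K` is a nonzero scalar. -/
theorem exists_res_ind_of_mem {K H : Subgroup G} (hKH : K ≤ H) {y : M.val K}
    (hy : y ∈ M.idemFixed hKH) : ∃ n : ℕ, n ≠ 0 ∧ M.res hKH (M.ind hKH y) = n • y := by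
  classical
  let Q := DoubleCoset.Quotient (K.subgroupOf H : Set H) (K.subgroupOf H : Set H)
  have : Finite Q := Quotient.finite _
  let := Fintype.ofFinite Q
  -- The Mackey summand of x fixes y if x normalizes K and kills y otherwise.
  have hterm : ∀ x : H, (M.ind (inf_le_left : K ⊓ conjSub (x : G) K ≤ K) ∘ₗ
      M.conj (x : G) (inf_conjSub_eq (x : G) K K) ∘ₗ
        M.res (inf_le_left : K ⊓ conjSub (x : G)⁻¹ K ≤ K)) y =
      if K = conjSub (x : G) K then y else 0 := by
    intro x
    split_ifs with hx
    · have hx' : K ≤ K ⊓ conjSub (x : G)⁻¹ K := by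
        refine le_inf le_rfl ?_
        conv_rhs => rw [hx, conjSub_conjSub, inv_mul_cancel, conjSub_one]
      have hn : x ∈ normIn K H := by
        refine Subgroup.mem_normalizer_iff_map_conj_eq.mpr ?_
        ext z
        change z ∈ conjSub x _ ↔ _
        rw [mem_conjSub, Subgroup.mem_subgroupOf, Subgroup.mem_subgroupOf]
        conv_rhs => rw [hx, mem_conjSub]
        rfl
      have hfix : M.conj (x : G) hx y = y := hy.2 (QuotientGroup.mk ⟨x, hn⟩)
      -- The intersection is equal to K but not definitionally so, hence the variable P.
      have key : ∀ {P : Subgroup G} (hP : P ≤ K), P = K → M.ind hP (M.res hP y) = y := by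
        rintro _ _ rfl
        rw [M.ind_self, M.res_self, LinearMap.id_apply, LinearMap.id_apply]
      rw [← M.res_comp_conj (x : G) (inf_conjSub_eq (x : G) K K) hx inf_le_left inf_le_left,
        LinearMap.comp_apply, LinearMap.comp_apply, hfix, key _ (inf_eq_left.mpr hx.le)]
    -- Here the summand first restricts y to a proper subgroup of K, which gives 0.
    · have hlt : K ⊓ conjSub (x : G)⁻¹ K < K := by
        refine lt_of_le_of_ne inf_le_left fun he => hx ?_
        have hle : K ≤ conjSub (x : G)⁻¹ K := inf_eq_left.mp he
        have := Subgroup.eq_of_le_of_card_ge hle (card_conjSub _ _).le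
        conv_lhs => rw [← conjSub_one K, ← mul_inv_cancel (x : G), ← conjSub_conjSub, ← this]
      rw [LinearMap.comp_apply, LinearMap.comp_apply, M.res_eq_zero_of_mem hlt hy.1, map_zero,
        map_zero]
  -- The scalar counts the double cosets whose representative normalizes K. It is nonzero because
  -- the representative of the trivial double coset lies in K.
  refine ⟨(Finset.univ.filter fun q : Q => K = conjSub ((Quotient.out q : H) : G) K).card, ?_, ?_⟩
  · refine Finset.card_ne_zero_of_mem (a := DoubleCoset.mk _ _ 1)
      (Finset.mem_filter.mpr ⟨Finset.mem_univ _, ?_⟩)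
    obtain ⟨k, l, hk, hl, he⟩ := DoubleCoset.mk_out_eq_mul (K.subgroupOf H) (K.subgroupOf H) 1
    refine conjSub_self (h := ((Quotient.out _ : H) : G)) ?_
    rw [he, mul_one]
    exact K.mul_mem hk hl
  · rw [← LinearMap.comp_apply, M.mackey hKH hKH, finsum_eq_sum_of_fintype, LinearMap.sum_apply,
      ← Finset.sum_const, Finset.sum_filter]
    exact Finset.sum_congr rfl fun q _ => hterm (Quotient.out q)

end RatMackeyFunctor

/-! ### The isomorphism -/

theorem mainTheorem3 {G : Type u} [Group G] [Finite G] (M : RatMackeyFunctor.{u, v} G)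
    {K H : Subgroup G} (hKH : K ≤ H) :
    ∃ φ : M.idemPart hKH ≃ₗ[ℚ] M.idemFixed hKH,
      ∀ x : M.idemPart hKH, (φ x : M.val K) = M.res hKH (x : M.val H) := by
  refine ⟨LinearEquiv.ofBijective
    ((M.res hKH).restrict fun _ => M.res_mem_idemFixed hKH) ⟨?_, ?_⟩, fun _ => rfl⟩
  · rw [injective_iff_map_eq_zero]
    rintro ⟨x, hx⟩ h
    have h₀ : M.res hKH x = 0 := congrArg Subtype.val h
    have h₁ := M.ind_res_of_mem hKH hx
    rw [h₀, map_zero, eq_comm, smul_eq_zero] at h₁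
    exact Subtype.ext (h₁.resolve_left (RatBurnside.mark_coset_self_ne_zero _))
  · rintro ⟨y, hy⟩
    obtain ⟨n, hn, h⟩ := M.exists_res_ind_of_mem hKH hy
    -- The preimage is n⁻¹ e_K^H I y. The idempotent forces membership in the summand and is
    -- harmless after restriction: R e_K^H I y = e_K^K R I y = n e_K^K y = n y.
    refine ⟨(n : ℚ)⁻¹ • ⟨_, M.burnsideAct_idem_mem hKH (M.ind hKH y)⟩, Subtype.ext ?_⟩
    change M.res hKH ((n : ℚ)⁻¹ • _) = y
    rw [map_smul, ← LinearMap.comp_apply, M.res_comp_burnsideAct, RatBurnside.restrict_idem,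
      LinearMap.comp_apply, h, ← Nat.cast_smul_eq_nsmul ℚ, map_smul,
      M.burnsideAct_idem_of_mem (le_refl K) hy.1, smul_smul,
      inv_mul_cancel₀ (Nat.cast_ne_zero.mpr hn), one_smul]
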